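/- Let $\mathbb K\in\{\mathbb R,\mathbb C\}$, let $X$ be a separable reflexive Banach space over $\mathbb K$, let $G=G_1\times\dots\times G_n$ be a product of topological groups with the product topology, and let $\pi$ be a strongly continuous representation of $G$ on $X$ by surjective linear isometries (that is, $g\mapsto\pi(g)x$ is continuous for every $x\in X$). For a topological group $H$ and a strongly continuous linear isometric representation $\rho$ of $H$ on a Banach space $E$, let $Z^1(H,\rho)$ be the space of continuous cocycles, i.e. continuous maps $b\colon H\to E$ with $b(gf)=\rho(g)b(f)+b(g)$ for all $g,f\in H$, with the topology given by the seminorms $\|b\|_K=\sup_{g\in K}\|b(g)\|$, $K\subseteq H$ compact. Let $B^1(H,\rho)\subseteq Z^1(H,\rho)$ be the subspace of coboundaries, i.e. those cocycles of the form $b(g)=x-\rho(g)x$ for some $x\in E$, and let $\overline{B^1(H,\rho)}$ be its closure in $Z^1(H,\rho)$. For a closed $\pi(G)$-invariant subspace $E\subseteq X$, let $\pi^E$ be the restriction of $\pi$ to $E$; $Z^1(G_i,\pi^E)$ and $B^1(G_i,\pi^E)$ refer to the restriction of $\pi^E$ to the factor $G_i\subseteq G$. Then there are closed $\pi(G)$-invariant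 linear subspaces $V,Y_1,\dots,Y_n,W$ of $X$ with $$X=V\oplus Y_1\oplus\dots\oplus Y_n\oplus W$$ such that 1. $V=\{x\in X:\pi(g)x=x\text{ for all }g\in G\}$; 2. for every $i$, every $b\in Z^1(G,\pi^{Y_i})$ factors through a cocycle defined on $G_i$: there is $c\in Z^1(G_i,\pi^{Y_i})$ with $b(g_1,\dots,g_n)=c(g_i)$ for all $(g_1,\dots,g_n)\in G$; 3. $Z^1(G,\pi^W)\subseteq\overline{B^1(G_1,\pi^W)}\oplus\dots\oplus\overline{B^1(G_n,\pi^W)}$, where $b\in Z^1(G,\pi^W)$ is identified with the tuple of its restrictions $(b|_{G_1},\dots,b|_{G_n})$; that is, the map $b\mapsto(b|_{G_1},\dots,b|_{G_n})$ is injective on $Z^1(G,\pi^W)$, and $b|_{G_i}\in\overline{B^1(G_i,\pi^W)}$ for every $b\in Z^1(G,\pi^W)$ and every $i$. -/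

import Mathlib

/-- A normed space is reflexive if the canonical isometric embedding into its bidual is onto. -/
def IsReflexiveSpace (𝕜 X : Type*) [RCLike 𝕜] [NormedAddCommGroup X] [NormedSpace 𝕜 X] : Prop :=
  Function.Surjective (NormedSpace.inclusionInDoubleDual 𝕜 X)

namespace IsometricRep

variable {𝕜 : Type*} [RCLike 𝕜] {X : Type*} [NormedAddCommGroup X] [NormedSpace 𝕜 X]

/-- Strong continuity of a linear isometric representation: all orbit maps are continuous. -/
def StronglyContinuous {G : Type*} [Group G] [TopologicalSpace G] (π : G →* (X ≃ₗᵢ[𝕜] X)) : Prop :=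
  ∀ x : X, Continuous fun g : G => π g x

/-- `W` is a `π(G)`-invariant subspace. -/
def IsInvariant {G : Type*} [Group G] (π : G →* (X ≃ₗᵢ[𝕜] X)) (W : Submodule 𝕜 X) : Prop :=
  ∀ g : G, ∀ x ∈ W, π g x ∈ W

/-- The subspace of `π(G)`-invariant vectors. -/
def invariants {G : Type*} [Group G] (π : G →* (X ≃ₗᵢ[𝕜] X)) : Submodule 𝕜 X where
  carrier := {x | ∀ g : G, π g x = x}
  zero_mem' := fun g => map_zero (π g)
  add_mem' := fun {x y} hx hy g => by rw [map_add, hx g, hy g]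
  smul_mem' := fun c x hx g => by rw [map_smul, hx g]

/-- The restriction `π^W` of the representation `π` to an invariant subspace `W`. -/
def subrep {G : Type*} [Group G] (π : G →* (X ≃ₗᵢ[𝕜] X)) (W : Submodule 𝕜 X)
    (hW : IsInvariant π W) : G →* (W ≃ₗᵢ[𝕜] W) where
  toFun g :=
    { toFun := fun x => ⟨π g x, hW g x x.2⟩
      invFun := fun x => ⟨π g⁻¹ x, hW g⁻¹ x x.2⟩
      map_add' := fun x y => Subtype.ext (map_add (π g) (x : X) (y : X))
      map_smul' := fun c x => Subtype.ext (map_smul (π g) c (x : X))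
      left_inv := fun x => Subtype.ext (by
        change (π g⁻¹ * π g) (x : X) = x
        rw [← map_mul, inv_mul_cancel, map_one]; rfl)
      right_inv := fun x => Subtype.ext (by
        change (π g * π g⁻¹) (x : X) = x
        rw [← map_mul, mul_inv_cancel, map_one]; rfl)
      norm_map' := fun x => (π g).norm_map (x : X) }
  map_one' := by
    ext x
    change π 1 (x : X) = x
    rw [map_one]; rfl
  map_mul' g h := by
    ext x
    change π (g * h) (x : X) = π g (π h x)
    rw [map_mul]; rfl

/-- `Z¹(G, π)`: the space of continuous cocycles `b : G → X`, i.e. continuous maps with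
`b (g f) = π(g) b(f) + b(g)`. It carries the topology induced by the compact-open topology of
`C(G, X)`, which is the topology of uniform convergence on compact subsets of `G`, i.e. the one
given by the seminorms `‖b‖_K = sup_{g ∈ K} ‖b(g)‖` for `K` compact. -/
def Z1 {G : Type*} [Group G] [TopologicalSpace G] (π : G →* (X ≃ₗᵢ[𝕜] X)) :
    Submodule 𝕜 C(G, X) where
  carrier := {b | ∀ g f : G, b (g * f) = π g (b f) + b g}
  zero_mem' := fun g f => by simp
  add_mem' := fun {b c} hb hc g f => by
    simp only [ContinuousMap.add_apply, hb g f, hc g f, map_add]; abel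
  smul_mem' := fun c b hb g f => by
    simp only [ContinuousMap.smul_apply, hb g f, map_smul, smul_add]

/-- `B¹(G, π)`: the subspace of coboundaries, i.e. cocycles `b` of the form
`b(g) = x - π(g) x` for some `x ∈ X`. -/
def B1 {G : Type*} [Group G] [TopologicalSpace G] (π : G →* (X ≃ₗᵢ[𝕜] X)) :
    Submodule 𝕜 (Z1 π) where
  carrier := {b | ∃ x : X, ∀ g : G, (b : C(G, X)) g = x - π g x}
  zero_mem' := ⟨0, fun g => by simp⟩
  add_mem' := by
    rintro b c ⟨x, hx⟩ ⟨y, hy⟩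
    refine ⟨x + y, fun g => ?_⟩
    change (b : C(G, X)) g + (c : C(G, X)) g = _
    rw [hx g, hy g, map_add]; abel
  smul_mem' := by
    rintro c b ⟨x, hx⟩
    refine ⟨c • x, fun g => ?_⟩
    change c • (b : C(G, X)) g = _
    rw [hx g, map_smul, smul_sub]

/-- The closure of `B¹(G, π)` in `Z¹(G, π)`. -/
def closureB1 {G : Type*} [Group G] [TopologicalSpace G] (π : G →* (X ≃ₗᵢ[𝕜] X)) :
    Submodule 𝕜 (Z1 π) :=
  (B1 π).topologicalClosure

/-- The restriction `π|_{G i}` of a representation of `∏ i, G i` to the factor `G i`. -/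
def restrictRep {n : ℕ} {G : Fin n → Type*} [∀ i, Group (G i)]
    (π : (∀ i, G i) →* (X ≃ₗᵢ[𝕜] X)) (i : Fin n) : G i →* (X ≃ₗᵢ[𝕜] X) :=
  π.comp (MonoidHom.mulSingle G i)

/-- The restriction `b ↦ b|_{G i}` of cocycles of `∏ i, G i` to the factor `G i`. -/
def restrictCocycle {n : ℕ} {G : Fin n → Type*} [∀ i, Group (G i)] [∀ i, TopologicalSpace (G i)]
    (π : (∀ i, G i) →* (X ≃ₗᵢ[𝕜] X)) (i : Fin n) : Z1 π →ₗ[𝕜] Z1 (restrictRep π i) where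
  toFun b := ⟨(b : C(∀ i, G i, X)).comp ⟨Pi.mulSingle i, continuous_mulSingle i⟩, fun g f => by
    change (b : C(∀ i, G i, X)) (Pi.mulSingle i (g * f)) = _
    rw [Pi.mulSingle_mul, b.2]; rfl⟩
  map_add' _ _ := rfl
  map_smul' _ _ := rfl

/-- The restriction map `Z¹(∏ i, G i, π) → ⨁ i, Z¹(G i, π)`, `b ↦ (b|_{G i})_i`. -/
def restrictAll {n : ℕ} {G : Fin n → Type*} [∀ i, Group (G i)] [∀ i, TopologicalSpace (G i)]
    (π : (∀ i, G i) →* (X ≃ₗᵢ[𝕜] X)) : Z1 π →ₗ[𝕜] (∀ i, Z1 (restrictRep π i)) :=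
  LinearMap.pi fun i => restrictCocycle π i

end IsometricRep

/-! Alaoglu–Birkhoff: for a normal subgroup N of a group of isometries of a separable reflexive
space, every closed convex hull of an N-orbit contains exactly one N-fixed vector, and sending x to
it is a linear equivariant projection (`exists_projection_fixedPoints`). Existence is a
Ryll-Nardzewski argument, carried out weak-* in a separable dual (`exists_fixedPoint_of_isCompact`)
and transported to X = X**; uniqueness and linearity come from invariant functionals on X.

Let P be the projection for N = G and Q_i the one for the complementary factor of G_i, that is, the
kernel of evaluation at i. A vector fixed by two different complementary factors is fixed by G, so
Q_i Q_j = P for i ≠ j, while P Q_i = Q_i P = P. Hence P, the Q_i - P, and 1 - P - ∑ (Q_i - P) are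
orthogonal idempotents with sum 1; their ranges are V, the Y_i and W.

On Y_i the complementary factor acts trivially and G has no nonzero invariant vector. Since a
cocycle sends an element acting trivially and commuting with G_i to a G_i-invariant vector, it
vanishes on the complementary factor.

On W every Q_i is zero, so 0 lies in the closed convex hull of each orbit of each complementary
factor. For f commuting with G_i, b - π(f) b is a coboundary on G_i. Products and convex
combinations T of such π(f) keep this property, and T can be made small on the compact set b(K), so
b - T b is a coboundary close to b on K. -/

open IsometricRep

/-! ### Minimal compact invariant sets and the fixed point theorem -/

/-- Among the nonempty compact subsets of `K` having a property stable under intersections there is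
a minimal one. -/
theorem IsCompact.exists_minimal_subset {F : Type*} [TopologicalSpace F] [T2Space F]
    (P : Set F → Prop) (hP : ∀ c : Set (Set F), (∀ s ∈ c, P s) → P (⋂₀ c)) {K : Set F}
    (hK : IsCompact K) (hKne : K.Nonempty) (hPK : P K) :
    ∃ Q ⊆ K, Q.Nonempty ∧ IsCompact Q ∧ P Q ∧
      ∀ Q' ⊆ Q, Q'.Nonempty → IsClosed Q' → P Q' → Q' = Q := by
  obtain ⟨Q, hQK, hQ⟩ := zorn_superset_nonempty
    {s : Set F | s.Nonempty ∧ IsCompact s ∧ P s}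
    (fun c hc hchain hne => by
      refine ⟨⋂₀ c, ⟨?_, ?_, hP c fun s hs => (hc hs).2.2⟩, fun s hs => Set.sInter_subset_of_mem hs⟩
      · exact IsCompact.nonempty_sInter_of_directed_nonempty_isCompact_isClosed
          (hS := hne.to_subtype)
          (fun a ha b hb => (hchain.total ha hb).elim (fun h => ⟨a, ha, subset_rfl, h⟩)
            fun h => ⟨b, hb, h, subset_rfl⟩)
          (fun s hs => (hc hs).1) (fun s hs => (hc hs).2.1) (fun s hs => (hc hs).2.1.isClosed)
      · obtain ⟨s, hs⟩ := hne
        exact (hc hs).2.1.of_isClosed_subset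
          (isClosed_sInter fun s hs => (hc hs).2.1.isClosed) (Set.sInter_subset_of_mem hs))
    K ⟨hKne, hK, hPK⟩
  refine ⟨Q, hQK, hQ.prop.1, hQ.prop.2.1, hQ.prop.2.2, fun Q' hQ' hne hcl hPQ' => ?_⟩
  exact subset_antisymm hQ' (hQ.le_of_le
    ⟨hne, hQ.prop.2.1.of_isClosed_subset hcl hQ', hPQ'⟩ hQ')

/-- A minimal compact invariant set which is separable for a lower semicontinuous invariant
seminorm is totally bounded for that seminorm. -/
theorem exists_finset_translates_of_minimal {F Γ : Type*} [AddCommGroup F] [Module ℝ F]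
    [TopologicalSpace F] [T2Space F] [Group Γ] (α : Γ →* Module.End ℝ F)
    (hα : ∀ g, Continuous (α g)) (p : Seminorm ℝ F) (hαp : ∀ g x, p (α g x) ≤ p x)
    (hp : ∀ a r, IsClosed {x | p (x - a) ≤ r}) (D : ℕ → F)
    {M : Set F} (hM : IsCompact M) (hMne : M.Nonempty) (hD : ∀ x ∈ M, ∀ ε > 0, ∃ k, p (x - D k) ≤ ε)
    (hMinv : ∀ g, ∀ x ∈ M, α g x ∈ M)
    (hmin : ∀ M' ⊆ M, M'.Nonempty → IsClosed M' → (∀ g, ∀ x ∈ M', α g x ∈ M') → M' = M)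
    {ε : ℝ} (hε : 0 < ε) :
    ∃ a ∈ M, ∃ t : Finset Γ, ∀ m ∈ M, ∃ g ∈ t, p (m - α g a) ≤ ε := by
  have hmul : ∀ g h x, α (g * h) x = α g (α h x) := fun g h x => by rw [map_mul]; rfl
  have hone : ∀ x, α 1 x = x := fun x => by rw [map_one]; rfl
  have : CompactSpace M := isCompact_iff_compactSpace.mp hM
  have : Nonempty M := hMne.to_subtype
  -- Baire category in the compact space `M`: countably many closed `p`-balls of radius `ε / 2`
  -- cover it, so one of them contains a nonempty relatively open piece.
  obtain ⟨k, hk⟩ := nonempty_interior_of_iUnion_of_closed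
    (f := fun k : ℕ => {x : M | p ((x : F) - D k) ≤ ε / 2})
    (fun k => (hp (D k) (ε / 2)).preimage continuous_subtype_val)
    (Set.eq_univ_of_forall fun x => by
      obtain ⟨k, hk⟩ := hD x x.2 (ε / 2) (by positivity)
      exact Set.mem_iUnion.mpr ⟨k, hk⟩)
  obtain ⟨⟨a, ha⟩, hak⟩ := hk
  obtain ⟨U, hU, hUeq⟩ := isOpen_induced_iff.mp
    (isOpen_interior (s := {x : M | p ((x : F) - D k) ≤ ε / 2}))
  have hUM : ∀ x ∈ M, x ∈ U → p (x - D k) ≤ ε / 2 := fun x hx hxU => by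
    have : (⟨x, hx⟩ : M) ∈ Subtype.val ⁻¹' U := hxU
    rw [hUeq] at this
    exact (interior_subset this : _)
  have haU : a ∈ U := by
    rw [← hUeq] at hak
    exact hak
  -- The points of `M` whose orbit misses `U` form a closed invariant subset that omits `a`; by
  -- minimality it is empty.
  have hcov : M ⊆ ⋃ g : Γ, (α g) ⁻¹' U := by
    by_contra hnot
    obtain ⟨x, hxM, hx⟩ := Set.not_subset.mp hnot
    have := hmin (M ∩ (⋃ g : Γ, (α g) ⁻¹' U)ᶜ) Set.inter_subset_left ⟨x, hxM, hx⟩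
      (hM.isClosed.inter (isOpen_iUnion fun g => hU.preimage (hα g)).isClosed_compl)
      (fun g y hy => ⟨hMinv g y hy.1, fun hmem => hy.2 (by
        obtain ⟨h, hh⟩ := Set.mem_iUnion.mp hmem
        exact Set.mem_iUnion.mpr ⟨h * g, by simpa [hmul] using hh⟩)⟩)
    exact (this.symm.subset ha).2 (Set.mem_iUnion.mpr ⟨1, by simpa [hone] using haU⟩)
  obtain ⟨t, ht⟩ := hM.elim_finite_subcover _ (fun g => hU.preimage (hα g)) hcov
  classical
  refine ⟨a, ha, t.image (·⁻¹), fun m hm => ?_⟩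
  obtain ⟨g, hg, hgU⟩ := Set.mem_iUnion₂.mp (ht hm)
  refine ⟨g⁻¹, Finset.mem_image_of_mem _ hg, ?_⟩
  have h1 : m - α g⁻¹ a = α g⁻¹ (α g m - a) := by
    rw [map_sub, ← hmul, inv_mul_cancel, hone]
  calc p (m - α g⁻¹ a) ≤ p (α g m - a) := h1 ▸ hαp _ _
    _ = p ((α g m - D k) - (a - D k)) := by congr 1; abel
    _ ≤ p (α g m - D k) + p (a - D k) := map_sub_le_add p _ _
    _ ≤ ε / 2 + ε / 2 := add_le_add (hUM _ (hMinv g m hm) hgU) (hUM a ha haU)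
    _ = ε := by ring

/-- **Ryll-Nardzewski fixed point theorem** for a group acting linearly, with an invariant,
lower semicontinuous and separable norm. -/
theorem exists_fixedPoint_of_isCompact {F Γ : Type*} [AddCommGroup F] [Module ℝ F]
    [TopologicalSpace F] [T2Space F] [Group Γ] (α : Γ →* Module.End ℝ F)
    (hα : ∀ g, Continuous (α g)) (p : Seminorm ℝ F) (hp0 : ∀ x, p x = 0 → x = 0)
    (hαp : ∀ g x, p (α g x) ≤ p x) (hp : ∀ a r, IsClosed {x | p (x - a) ≤ r}) (D : ℕ → F)
    {K : Set F} (hD : ∀ x ∈ K, ∀ ε > 0, ∃ k, p (x - D k) ≤ ε) (hK : IsCompact K)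
    (hKne : K.Nonempty) (hKconv : Convex ℝ K) {R : ℝ} (hKR : ∀ x ∈ K, p x ≤ R)
    (hKinv : ∀ g, ∀ x ∈ K, α g x ∈ K) :
    ∃ x ∈ K, ∀ g, α g x = x := by
  have hmul : ∀ g h x, α (g * h) x = α g (α h x) := fun g h x => by rw [map_mul]; rfl
  have hone : ∀ x, α 1 x = x := fun x => by rw [map_one]; rfl
  obtain ⟨Q, hQK, hQne, hQcomp, ⟨hQconv, hQinv⟩, hQmin⟩ := hK.exists_minimal_subset
    (fun Q => Convex ℝ Q ∧ ∀ g, ∀ x ∈ Q, α g x ∈ Q)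
    (fun c hc => ⟨convex_sInter fun s hs => (hc s hs).1,
      fun g x hx s hs => (hc s hs).2 g x (hx s hs)⟩) hKne ⟨hKconv, hKinv⟩
  obtain ⟨M, hMQ, hMne, hMcomp, hMinv, hMmin⟩ := hQcomp.exists_minimal_subset
    (fun M => ∀ g, ∀ x ∈ M, α g x ∈ M)
    (fun c hc g x hx s hs => hc s hs g x (hx s hs)) hQne hQinv
  by_cases hsub : ∀ x ∈ Q, ∀ y ∈ Q, p (x - y) = 0
  · obtain ⟨x, hx⟩ := hQne
    exact ⟨x, hQK hx, fun g => sub_eq_zero.mp (hp0 _ (hsub _ (hQinv g x hx) _ hx))⟩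
  exfalso
  push Not at hsub
  obtain ⟨x₀, hx₀, y₀, hy₀, hxy⟩ := hsub
  set S : Set ℝ := {s | ∃ x ∈ Q, ∃ y ∈ Q, s = p (x - y)} with hS
  have hSb : BddAbove S := ⟨R + R, by
    rintro _ ⟨x, hx, y, hy, rfl⟩
    exact (map_sub_le_add p x y).trans (add_le_add (hKR x (hQK hx)) (hKR y (hQK hy)))⟩
  have hSne : S.Nonempty := ⟨_, x₀, hx₀, y₀, hy₀, rfl⟩
  have hle : ∀ x ∈ Q, ∀ y ∈ Q, p (x - y) ≤ sSup S := fun x hx y hy =>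
    le_csSup hSb ⟨x, hx, y, hy, rfl⟩
  set d := sSup S with hd
  have hd0 : 0 < d := lt_of_lt_of_le (lt_of_le_of_ne (apply_nonneg p _) (Ne.symm hxy))
    (hle x₀ hx₀ y₀ hy₀)
  obtain ⟨a, ha, t, ht⟩ := exists_finset_translates_of_minimal α hα p hαp hp D hMcomp hMne
    (fun x hx => hD x (hQK (hMQ hx))) hMinv hMmin (half_pos hd0)
  have htne : t.Nonempty := by
    obtain ⟨m, hm⟩ := hMne
    obtain ⟨g, hg, -⟩ := ht m hm
    exact ⟨g, hg⟩
  have hN : (0 : ℝ) < t.card := by exact_mod_cast htne.card_pos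
  set z : F := ∑ g ∈ t, (t.card : ℝ)⁻¹ • α g a with hz
  have hw : ∑ g ∈ t, (t.card : ℝ)⁻¹ = 1 := by
    rw [Finset.sum_const, nsmul_eq_mul, mul_inv_cancel₀ hN.ne']
  have hzQ : z ∈ Q := hQconv.sum_mem (fun g _ => by positivity) hw
    (fun g _ => hQinv g a (hMQ ha))
  -- `z` averages the finite `d / 2`-net of translates. From any `m ∈ M`, one net point is at
  -- distance at most `d / 2` and the others at most `d`, so the average distance is at most this `r
  -- < d`.
  set r : ℝ := d - d / 2 * (t.card : ℝ)⁻¹ with hr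
  have hrd : r < d := by
    rw [hr]
    have : 0 < d / 2 * (t.card : ℝ)⁻¹ := by positivity
    linarith
  have hzr : ∀ m ∈ M, p (m - z) ≤ r := fun m hm => by
    obtain ⟨g₀, hg₀, hpg₀⟩ := ht m hm
    have hmz : m - z = ∑ g ∈ t, (t.card : ℝ)⁻¹ • (m - α g a) := by
      simp only [smul_sub, Finset.sum_sub_distrib]
      rw [← Finset.sum_smul, hw, one_smul]
    have h1 : p (m - z) ≤ ∑ g ∈ t, (t.card : ℝ)⁻¹ * p (m - α g a) := by
      rw [hmz]
      refine (Finset.le_sum_of_subadditive p (map_zero p).le (map_add_le_add p) t _).trans (Finset.sum_le_sum fun g _ => ?_)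
      rw [map_smul_eq_mul, Real.norm_of_nonneg (by positivity)]
    refine h1.trans ?_
    rw [← Finset.mul_sum]
    have h2 : ∑ g ∈ t, p (m - α g a) ≤ t.card * d - d / 2 := by
      classical
      rw [← Finset.add_sum_erase t _ hg₀]
      have h3 : ∑ g ∈ t.erase g₀, p (m - α g a) ≤ (t.erase g₀).card • d :=
        Finset.sum_le_card_nsmul _ _ _ fun g _ => hle _ (hMQ hm) _ (hQinv g a (hMQ ha))
      rw [nsmul_eq_mul, Finset.card_erase_of_mem hg₀, Nat.cast_sub htne.card_pos] at h3
      push_cast at h3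
      linarith
    calc (t.card : ℝ)⁻¹ * ∑ g ∈ t, p (m - α g a) ≤ (t.card : ℝ)⁻¹ * (t.card * d - d / 2) := by
          gcongr
      _ = r := by rw [hr]; field_simp
  have hball : ∀ x, Convex ℝ {q | p (q - x) ≤ r} := fun x => by
    have : {q | p (q - x) ≤ r} = p.closedBall x r := by
      ext q
      rw [Seminorm.mem_closedBall]; rfl
    rw [this]
    exact p.convex_closedBall x r
  have hswap : ∀ g x y, p (x - α g y) ≤ p (α g⁻¹ x - y) := fun g x y => by
    have : x - α g y = α g (α g⁻¹ x - y) := by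
      rw [map_sub, ← hmul, mul_inv_cancel, hone]
    rw [this]
    exact hαp _ _
  -- For invariant `T`, the `q ∈ Q` within `r` of all of `T` form a closed convex invariant set; if
  -- nonempty it is `Q`, by minimality. Used for `T = M` with centre `z`, then for `T = Q` with
  -- centre a point of `M`, this bounds the diameter of `Q` by `r < d`.
  have key : ∀ T : Set F, (∀ g, ∀ x ∈ T, α g x ∈ T) → (∃ z ∈ Q, ∀ x ∈ T, p (x - z) ≤ r) →
      ∀ q ∈ Q, ∀ x ∈ T, p (x - q) ≤ r := by
    intro T hT hne
    have hA : {q | q ∈ Q ∧ ∀ x ∈ T, p (x - q) ≤ r} = Q ∩ ⋂ x ∈ T, {q | p (q - x) ≤ r} := by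
      ext q
      simp only [Set.mem_ofPred_eq, Set.mem_inter_iff, Set.mem_iInter, map_sub_rev p q]
    have := hQmin {q | q ∈ Q ∧ ∀ x ∈ T, p (x - q) ≤ r} (fun q hq => hq.1)
      (by obtain ⟨z, hz, h⟩ := hne; exact ⟨z, hz, h⟩)
      (by rw [hA]; exact hQcomp.isClosed.inter (isClosed_biInter fun x _ => hp x r))
      ⟨by rw [hA]; exact hQconv.inter (convex_iInter₂ fun x _ => hball x),
        fun g q hq => ⟨hQinv g q hq.1, fun x hx =>
          (hswap g x q).trans (hq.2 _ (hT g⁻¹ x hx))⟩⟩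
    intro q hq
    rw [← this] at hq
    exact hq.2
  have hM : ∀ q ∈ Q, ∀ m ∈ M, p (m - q) ≤ r := key M hMinv ⟨z, hzQ, hzr⟩
  obtain ⟨m, hm⟩ := hMne
  have hQQ : ∀ q ∈ Q, ∀ x ∈ Q, p (x - q) ≤ r := key Q hQinv
    ⟨m, hMQ hm, fun x hx => by rw [map_sub_rev]; exact hM x hx m hm⟩
  have : d ≤ r := csSup_le hSne (by
    rintro _ ⟨x, hx, y, hy, rfl⟩
    exact hQQ y hy x hx)
  linarith

/-! ### Separable duals and invariant functionals -/

section DualSpaces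

variable {𝕜 : Type*} [RCLike 𝕜] {X : Type*} [NormedAddCommGroup X] [NormedSpace 𝕜 X]

/-- A normed space with separable dual is separable. -/
theorem separableSpace_of_separableSpace_strongDual
    [TopologicalSpace.SeparableSpace (StrongDual 𝕜 X)] : TopologicalSpace.SeparableSpace X := by
  obtain ⟨u, hu⟩ := TopologicalSpace.exists_dense_seq (StrongDual 𝕜 X)
  have hv : ∀ k, ∃ x : X, ‖x‖ ≤ 1 ∧ ‖u k‖ / 2 ≤ ‖u k x‖ := by
    intro k
    rcases eq_or_ne (u k) 0 with h | h
    · exact ⟨0, by simp, by simp [h]⟩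
    · obtain ⟨x, hx, hlt⟩ := (u k).exists_lt_apply_of_lt_opNorm
        (half_lt_self (norm_pos_iff.mpr h))
      exact ⟨x, hx.le, hlt.le⟩
  choose v hv1 hv2 using hv
  set S : Submodule 𝕜 X := (Submodule.span 𝕜 (Set.range v)).topologicalClosure with hS
  have hvS : ∀ k, v k ∈ S := fun k =>
    Submodule.le_topologicalClosure _ (Submodule.subset_span ⟨k, rfl⟩)
  have hsep : TopologicalSpace.IsSeparable (S : Set X) := by
    rw [hS, Submodule.topologicalClosure_coe]
    exact ((Set.countable_range v).isSeparable.span (R := 𝕜)).closure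
  have htop : S = ⊤ := by
    by_contra hne
    obtain ⟨x, hx⟩ : ∃ x, x ∉ S := by
      by_contra! h
      exact hne (eq_top_iff.mpr fun x _ => h x)
    have hcl : IsClosed (S : Set X) := Submodule.isClosed_topologicalClosure _
    obtain ⟨φ, hφS, hφ⟩ : ∃ φ : StrongDual 𝕜 X, (∀ s ∈ S, φ s = 0) ∧ φ ≠ 0 := by
      have hq : ‖S.mkQ x‖ ≠ 0 := by
        rw [Submodule.mkQ_apply, norm_ne_zero_iff, Ne, Submodule.Quotient.mk_eq_zero]
        exact hx
      obtain ⟨g, -, hg⟩ := exists_dual_vector 𝕜 (S.mkQ x) hq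
      refine ⟨g.comp S.mkQL, fun s hs => ?_, fun h => ?_⟩
      · have : S.mkQ s = 0 := by simpa using hs
        change g (S.mkQ s) = 0
        rw [this, map_zero]
      · have h1 : g (S.mkQ x) = 0 := congrArg (fun f : StrongDual 𝕜 X => f x) h
        rw [hg] at h1
        exact hq (by exact_mod_cast h1)
    have hφ0 : 0 < ‖φ‖ := norm_pos_iff.mpr hφ
    obtain ⟨k, hk⟩ := hu.exists_dist_lt φ (show 0 < ‖φ‖ / 4 by positivity)
    rw [dist_eq_norm] at hk
    have h1 : ‖u k (v k)‖ ≤ ‖φ - u k‖ := by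
      have : u k (v k) = -((φ - u k) (v k)) := by
        rw [sub_apply, hφS _ (hvS k)]; ring
      rw [this, norm_neg]
      exact ((φ - u k).le_opNorm _).trans
        (mul_le_of_le_one_right (norm_nonneg _) (hv1 k))
    have h2 : ‖φ‖ ≤ ‖φ - u k‖ + ‖u k‖ := by
      simpa using norm_add_le (φ - u k) (u k)
    linarith [hv2 k]
  rw [htop] at hsep
  exact TopologicalSpace.isSeparable_univ_iff.mp hsep

/-- In a separable dual space, every functional has an invariant functional in the weak-* closed
convex hull of its orbit under a group of contractions. -/
theorem exists_invariant_functional [TopologicalSpace.SeparableSpace (StrongDual 𝕜 X)]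
    {Γ : Type*} [Group Γ] (ρ : Γ →* (X →L[𝕜] X)) (hρ : ∀ g x, ‖ρ g x‖ ≤ ‖x‖)
    (φ : StrongDual 𝕜 X) :
    ∃ ψ : StrongDual 𝕜 X, (∀ g x, ψ (ρ g x) = ψ x) ∧
      ∀ (y : X) (s : ℝ), (∀ g, s ≤ RCLike.re (φ (ρ g y))) → s ≤ RCLike.re (ψ y) := by
  have hmul : ∀ g h x, ρ (g * h) x = ρ g (ρ h x) := fun g h x => by rw [map_mul]; rfl
  have hone : ∀ x, ρ 1 x = x := fun x => by rw [map_one]; rfl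
  have hadd : ∀ (f h : WeakDual 𝕜 X) (x : X), (f + h) x = f x + h x := fun _ _ _ => rfl
  have hsmul : ∀ (c : ℝ) (f : WeakDual 𝕜 X) (x : X), (c • f) x = c • f x := fun _ _ _ => rfl
  let α : Γ →* Module.End ℝ (WeakDual 𝕜 X) :=
    { toFun := fun g =>
        { toFun := fun f => StrongDual.toWeakDual ((WeakDual.toStrongDual f).comp (ρ g⁻¹))
          map_add' := fun f h => rfl
          map_smul' := fun c f => rfl }
      map_one' := by
        refine LinearMap.ext fun f => DFunLike.ext _ _ fun x => ?_
        change f (ρ 1⁻¹ x) = f x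
        rw [inv_one, hone]
      map_mul' := fun g h => by
        refine LinearMap.ext fun f => DFunLike.ext _ _ fun x => ?_
        change f (ρ (g * h)⁻¹ x) = f (ρ h⁻¹ (ρ g⁻¹ x))
        rw [mul_inv_rev, hmul] }
  have hα : ∀ g f x, α g f x = f (ρ g⁻¹ x) := fun g f x => rfl
  let L : WeakDual 𝕜 X →ₗ[ℝ] StrongDual 𝕜 X :=
    { toFun := fun f => WeakDual.toStrongDual f
      map_add' := fun f h => rfl
      map_smul' := fun c f => rfl }
  let p := (normSeminorm ℝ (StrongDual 𝕜 X)).comp L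
  have hp : ∀ f, p f = ‖WeakDual.toStrongDual f‖ := fun f => rfl
  -- The weak-* closed convex hull of the orbit of `φ`, described by the closed half-spaces
  -- containing it.
  set K : Set (WeakDual 𝕜 X) := {f | ∀ (y : X) (s : ℝ),
    (∀ g, s ≤ RCLike.re (φ (ρ g y))) → s ≤ RCLike.re (f y)} with hKdef
  have hKcl : IsClosed K := by
    simp only [hKdef, Set.ofPred_forall]
    exact isClosed_iInter fun y => isClosed_iInter fun s => isClosed_iInter fun _ =>
      isClosed_le continuous_const (RCLike.continuous_re.comp (WeakDual.eval_continuous y))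
  have hKR : ∀ f ∈ K, p f ≤ ‖φ‖ := fun f hf => by
    rw [hp]
    refine ContinuousLinearMap.opNorm_le_bound _ (norm_nonneg _) fun x => ?_
    rw [WeakDual.toStrongDual_apply]
    -- Half-spaces control only real parts, so `x` is rotated until the value of `f` is `-‖f x‖`.
    obtain ⟨c, hc1, hc⟩ : ∃ c : 𝕜, ‖c‖ = 1 ∧ c * f x = -(‖f x‖ : 𝕜) := by
      rcases eq_or_ne (f x) 0 with h | h
      · exact ⟨1, by simp, by simp [h]⟩
      · refine ⟨-(‖f x‖ : 𝕜) / f x, ?_, by field_simp⟩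
        rw [norm_div, norm_neg, RCLike.norm_ofReal, abs_norm, div_self (norm_ne_zero_iff.mpr h)]
    have h1 := hf (c • x) (-(‖φ‖ * ‖x‖)) (fun g => by
      have h2 : ‖φ (ρ g (c • x))‖ ≤ ‖φ‖ * ‖x‖ := (φ.le_opNorm _).trans (by
        gcongr
        refine (hρ g _).trans ?_
        rw [norm_smul, hc1, one_mul])
      exact (neg_le_neg h2).trans (neg_le_of_abs_le (RCLike.abs_re_le_norm _)))
    rw [map_smul, smul_eq_mul, hc, map_neg, RCLike.ofReal_re] at h1
    linarith
  have hKcomp : IsCompact K :=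
    (WeakDual.isCompact_closedBall (0 : StrongDual 𝕜 X) ‖φ‖).of_isClosed_subset hKcl
      fun f hf => by simpa [hp] using hKR f hf
  have hKconv : Convex ℝ K := by
    intro f hf h hh a b ha hb hab y s hs
    rw [hadd, hsmul, hsmul, map_add, RCLike.smul_re, RCLike.smul_re]
    calc s = a * s + b * s := by rw [← add_mul, hab, one_mul]
      _ ≤ _ := add_le_add (mul_le_mul_of_nonneg_left (hf y s hs) ha)
          (mul_le_mul_of_nonneg_left (hh y s hs) hb)
  obtain ⟨u, hu⟩ := TopologicalSpace.exists_dense_seq (StrongDual 𝕜 X)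
  obtain ⟨ψ, hψK, hψ⟩ := exists_fixedPoint_of_isCompact α
    (fun g => WeakDual.continuous_of_continuous_eval fun y => by
      simp only [hα]
      exact WeakDual.eval_continuous _) p
    (fun f hf => by simpa [hp] using hf)
    (fun g f => by
      rw [hp, hp]
      refine ContinuousLinearMap.opNorm_le_bound _ (norm_nonneg _) fun x => ?_
      rw [WeakDual.toStrongDual_apply, hα]
      exact ((WeakDual.toStrongDual f).le_opNorm _).trans (by gcongr; exact hρ _ _))
    (fun a r => by
      have := WeakDual.isClosed_closedBall (WeakDual.toStrongDual a) r
      convert this using 1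
      ext f
      simp [hp, dist_eq_norm])
    (fun k => StrongDual.toWeakDual (u k)) (K := K)
    (fun f _ ε hε => by
      obtain ⟨k, hk⟩ := hu.exists_dist_lt (WeakDual.toStrongDual f) hε
      exact ⟨k, by rw [dist_eq_norm] at hk; simpa [hp] using hk.le⟩)
    hKcomp ⟨StrongDual.toWeakDual φ, fun y s hs => by simpa [hone] using hs 1⟩ hKconv hKR
    (fun g f hf y s hs => by
      rw [hα]
      exact hf _ s fun h => by rw [← hmul]; exact hs _)
  refine ⟨WeakDual.toStrongDual ψ, fun g x => ?_, fun y s hs => hψK y s hs⟩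
  have := congrArg (fun f : WeakDual 𝕜 X => f x) (hψ g⁻¹)
  simpa [hα] using this

end DualSpaces

/-! ### Equivariant projections onto fixed vectors -/

section Projections

variable {𝕜 : Type*} [RCLike 𝕜] {X : Type*} [NormedAddCommGroup X] [NormedSpace 𝕜 X]

/-- Every functional agrees on the fixed points of a group of linear isometries with an invariant
functional. -/
theorem exists_invariant_functional_eq_on_fixed [TopologicalSpace.SeparableSpace (StrongDual 𝕜 X)]
    {Γ : Type*} [Group Γ] (ρ : Γ →* (X ≃ₗᵢ[𝕜] X)) (φ : StrongDual 𝕜 X) :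
    ∃ ψ : StrongDual 𝕜 X, (∀ g x, ψ (ρ g x) = ψ x) ∧ ∀ z, (∀ g, ρ g z = z) → ψ z = φ z := by
  let τ : Γ →* (X →L[𝕜] X) :=
    { toFun := fun g => ((ρ g).toContinuousLinearEquiv : X →L[𝕜] X)
      map_one' := by
        refine ContinuousLinearMap.ext fun y => ?_
        change ρ 1 y = y
        rw [map_one]; rfl
      map_mul' := fun g h => by
        refine ContinuousLinearMap.ext fun y => ?_
        change ρ (g * h) y = ρ g (ρ h y)
        rw [map_mul]; rfl }
  have hτ : ∀ g y, τ g y = ρ g y := fun _ _ => rfl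
  obtain ⟨ψ, hψ, hψφ⟩ := exists_invariant_functional τ
    (fun g y => by rw [hτ, LinearIsometryEquiv.norm_map]) φ
  refine ⟨ψ, fun g x => hψ g x, fun z hz => ?_⟩
  -- The orbit condition is one-sided and real; testing it on `z`, `-z` and `I • z` gives equality
  -- of real and imaginary parts.
  have hle : ∀ z, (∀ g, ρ g z = z) → RCLike.re (φ z) ≤ RCLike.re (ψ z) := fun z hz =>
    hψφ z _ fun g => by rw [hτ, hz g]
  have hre : ∀ z, (∀ g, ρ g z = z) → RCLike.re (ψ z) = RCLike.re (φ z) := fun z hz => by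
    have h1 := hle z hz
    have h2 := hle (-z) fun g => by rw [map_neg, hz g]
    simp only [map_neg] at h2
    linarith
  refine RCLike.ext (hre z hz) ?_
  have h3 := hre ((RCLike.I : 𝕜) • z) fun g => by rw [map_smul, hz g]
  simpa using h3

variable [NormedSpace ℝ X] [IsScalarTower ℝ 𝕜 X]

/-- In a separable reflexive space, the closed convex hull of every orbit of a group of linear
isometries contains a fixed point. -/
theorem exists_fixed_mem_closure_convexHull_orbit [TopologicalSpace.SeparableSpace X]
    (hX : IsReflexiveSpace 𝕜 X) {Γ : Type*} [Group Γ] (ρ : Γ →* (X ≃ₗᵢ[𝕜] X)) (x : X) :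
    ∃ z ∈ closure (convexHull ℝ (Set.range fun g => ρ g x)), ∀ g, ρ g z = z := by
  have : TopologicalSpace.SeparableSpace (StrongDual 𝕜 (StrongDual 𝕜 X)) :=
    hX.denseRange.separableSpace (NormedSpace.inclusionInDoubleDual 𝕜 X).continuous
  let τ : Γ →* (StrongDual 𝕜 X →L[𝕜] StrongDual 𝕜 X) :=
    { toFun := fun g => (ContinuousLinearMap.compL 𝕜 X X 𝕜).flip
        ((ρ g⁻¹).toContinuousLinearEquiv : X →L[𝕜] X)
      map_one' := by
        refine ContinuousLinearMap.ext fun φ => ContinuousLinearMap.ext fun y => ?_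
        change φ (ρ 1⁻¹ y) = φ y
        rw [inv_one, map_one]; rfl
      map_mul' := fun g h => by
        refine ContinuousLinearMap.ext fun φ => ContinuousLinearMap.ext fun y => ?_
        change φ (ρ (g * h)⁻¹ y) = φ (ρ h⁻¹ (ρ g⁻¹ y))
        rw [mul_inv_rev, map_mul]; rfl }
  have hτ : ∀ g φ y, τ g φ y = φ (ρ g⁻¹ y) := fun _ _ _ => rfl
  -- The theorem is applied to the contragredient action on the dual, starting from evaluation at
  -- `x`; reflexivity turns the invariant functional into a vector.
  obtain ⟨ξ, hξ, hξx⟩ := exists_invariant_functional τ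
    (fun g φ => ContinuousLinearMap.opNorm_le_bound _ (norm_nonneg _) fun y => by
      rw [hτ]
      simpa using φ.le_opNorm (ρ g⁻¹ y)) (NormedSpace.inclusionInDoubleDual 𝕜 X x)
  obtain ⟨z, rfl⟩ := hX ξ
  refine ⟨z, ?_, fun g => ?_⟩
  · by_contra hz
    obtain ⟨φ, s, hs, hsφ⟩ := RCLike.geometric_hahn_banach_point_closed (𝕜 := 𝕜)
      (convex_convexHull ℝ (Set.range fun g => ρ g x)).closure isClosed_closure hz
    have := hξx φ s fun g => by
      rw [NormedSpace.dual_def, hτ]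
      exact (hsφ _ (subset_closure (subset_convexHull ℝ _ ⟨g⁻¹, rfl⟩))).le
    rw [NormedSpace.dual_def] at this
    linarith
  · refine (NormedSpace.inclusionInDoubleDualLi 𝕜 (E := X)).injective
      (ContinuousLinearMap.ext fun φ => ?_)
    have := hξ g⁻¹ φ
    simp only [NormedSpace.dual_def, hτ, inv_inv] at this
    exact this

/-- **Alaoglu–Birkhoff decomposition**: for a normal subgroup `N` of a group acting by linear
isometries on a separable reflexive space, there is an equivariant projection onto the space of
`N`-fixed vectors, mapping every vector into the closed convex hull of its `N`-orbit. -/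
theorem exists_projection_fixedPoints [TopologicalSpace.SeparableSpace X]
    (hX : IsReflexiveSpace 𝕜 X) {G : Type*} [Group G] (π : G →* (X ≃ₗᵢ[𝕜] X))
    (N : Subgroup G) [N.Normal] :
    ∃ Q : X →L[𝕜] X, (∀ x, ∀ n ∈ N, π n (Q x) = Q x) ∧
      (∀ x, (∀ n ∈ N, π n x = x) → Q x = x) ∧ (∀ g x, Q (π g x) = π g (Q x)) ∧
      ∀ x, Q x ∈ closure (convexHull ℝ ((fun n => π n x) '' N)) := by
  have hsep : TopologicalSpace.SeparableSpace (StrongDual 𝕜 X) := by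
    have : TopologicalSpace.SeparableSpace (StrongDual 𝕜 (StrongDual 𝕜 X)) :=
      hX.denseRange.separableSpace (NormedSpace.inclusionInDoubleDual 𝕜 X).continuous
    exact separableSpace_of_separableSpace_strongDual (𝕜 := 𝕜)
  have hmul : ∀ g h x, π (g * h) x = π g (π h x) := fun g h x => by rw [map_mul]; rfl
  have hone : ∀ x, π 1 x = x := fun x => by rw [map_one]; rfl
  set C : X → Set X := fun x => closure (convexHull ℝ ((fun n => π n x) '' N)) with hC
  have hex : ∀ x, ∃ z ∈ C x, ∀ n ∈ N, π n z = z := fun x => by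
    obtain ⟨z, hz, hzN⟩ := exists_fixed_mem_closure_convexHull_orbit hX (π.comp N.subtype) x
    refine ⟨z, ?_, fun n hn => hzN ⟨n, hn⟩⟩
    simp only [hC, Set.image_eq_range]
    exact hz
  choose q hqC hqN using hex
  -- An invariant `ψ` agreeing with `φ` on fixed vectors is constant on `C x`, so `φ z = ψ x` for
  -- every fixed `z ∈ C x`. This yields uniqueness of `z`, and linearity of `q` because `φ ∘ q = ψ`.
  have hinv : ∀ φ : StrongDual 𝕜 X, ∃ ψ : StrongDual 𝕜 X,
      ∀ x z, z ∈ C x → (∀ n ∈ N, π n z = z) → φ z = ψ x := fun φ => by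
    obtain ⟨ψ, hψ, hψφ⟩ := exists_invariant_functional_eq_on_fixed (π.comp N.subtype) φ
    refine ⟨ψ, fun x z hz hzN => ?_⟩
    rw [← hψφ z fun n => hzN n n.2]
    have hsub : C x ⊆ {y | ψ y = ψ x} := by
      refine closure_minimal (convexHull_min ?_ ?_) (isClosed_eq ψ.continuous continuous_const)
      · rintro _ ⟨n, hn, rfl⟩
        exact hψ ⟨n, hn⟩ x
      · intro u hu v hv a b _ _ hab
        change ψ (a • u + b • v) = ψ x
        have hu' : ψ u = ψ x := hu
        have hv' : ψ v = ψ x := hv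
        rw [map_add, ContinuousLinearMap.map_smul_of_tower, ContinuousLinearMap.map_smul_of_tower,
          hu', hv', ← add_smul, hab, one_smul]
    exact hsub hz
  have hsepd : ∀ z w : X, (∀ φ : StrongDual 𝕜 X, φ z = φ w) → z = w := fun z w h =>
    (NormedSpace.inclusionInDoubleDualLi 𝕜 (E := X)).injective (ContinuousLinearMap.ext h)
  have huniq : ∀ x z, z ∈ C x → (∀ n ∈ N, π n z = z) → q x = z := fun x z hz hzN =>
    hsepd _ _ fun φ => by
      obtain ⟨ψ, hψ⟩ := hinv φ
      rw [hψ x _ (hqC x) (hqN x), hψ x z hz hzN]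
  have hqψ : ∀ φ : StrongDual 𝕜 X, ∃ ψ : StrongDual 𝕜 X, ∀ x, φ (q x) = ψ x := fun φ => by
    obtain ⟨ψ, hψ⟩ := hinv φ
    exact ⟨ψ, fun x => hψ x _ (hqC x) (hqN x)⟩
  let q' : X →ₗ[𝕜] X :=
    { toFun := q
      map_add' := fun x y => hsepd _ _ fun φ => by
        obtain ⟨ψ, hψ⟩ := hqψ φ
        rw [map_add, hψ, hψ, hψ, map_add]
      map_smul' := fun c x => hsepd _ _ fun φ => by
        obtain ⟨ψ, hψ⟩ := hqψ φ
        rw [RingHom.id_apply, map_smul, hψ, hψ, map_smul] }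
  have hnorm : ∀ x, ‖q' x‖ ≤ 1 * ‖x‖ := fun x => by
    have hsub : C x ⊆ Metric.closedBall 0 ‖x‖ := by
      refine closure_minimal (convexHull_min ?_ (convex_closedBall _ _)) Metric.isClosed_closedBall
      rintro _ ⟨n, _, rfl⟩
      simp
    simpa [q'] using hsub (hqC x)
  refine ⟨q'.mkContinuous 1 hnorm, hqN, fun x hx => huniq x x ?_ hx, fun g x => ?_, hqC⟩
  · exact subset_closure (subset_convexHull ℝ _ ⟨1, N.one_mem, hone x⟩)
  · refine huniq (π g x) (π g (q x)) ?_ fun n hn => ?_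
    · have hmaps : Set.MapsTo (π g) (C x) (C (π g x)) := by
        refine Set.MapsTo.closure ?_ (π g).continuous
        refine fun y hy => convexHull_min (t := π g ⁻¹' convexHull ℝ
          ((fun n => π n (π g x)) '' N)) ?_ ?_ hy
        · rintro _ ⟨n, hn, rfl⟩
          refine subset_convexHull ℝ _ ⟨g * n * g⁻¹, ‹N.Normal›.conj_mem n hn g, ?_⟩
          change π (g * n * g⁻¹) (π g x) = π g (π n x)
          rw [← hmul, ← hmul, inv_mul_cancel_right]
        · exact (convex_convexHull ℝ _).is_linear_preimage
            ⟨map_add (π g), fun c y =>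
              ((π g).toContinuousLinearEquiv : X →L[𝕜] X).map_smul_of_tower c y⟩
      exact hmaps (hqC x)
    · have h1 : n * g = g * (g⁻¹ * n * g) := by group
      rw [← hmul, h1, hmul, hqN]
      simpa using ‹N.Normal›.conj_mem n hn g⁻¹

end Projections

/-! ### Averaging operators and approximation by coboundaries -/

section Cocycles

variable {𝕜 : Type*} [RCLike 𝕜] {E : Type*} [NormedAddCommGroup E] [NormedSpace 𝕜 E]
  [NormedSpace ℝ E]

/-- The averaging operators attached to a cocycle `b` and a subset `H` of the group: contractions
`T` commuting with `σ(H)` such that `b - T b` is a coboundary on `H`. -/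
structure IsAveraging {G : Type*} [Group G] (σ : G →* (E ≃ₗᵢ[𝕜] E)) (b : G → E) (H : Set G)
    (T : E →L[ℝ] E) : Prop where
  norm_le : ∀ x, ‖T x‖ ≤ ‖x‖
  comm : ∀ h ∈ H, ∀ x, T (σ h x) = σ h (T x)
  coboundary : ∃ w, ∀ h ∈ H, b h - T (b h) = w - σ h w

namespace IsAveraging

variable {G : Type*} [Group G] {σ : G →* (E ≃ₗᵢ[𝕜] E)} {b : G → E} {H : Set G}

theorem one : IsAveraging σ b H (1 : E →L[ℝ] E) :=
  ⟨fun _ => le_rfl, fun _ _ _ => rfl, 0, fun h _ => by simp⟩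

/-- `b - S T b = (b - S b) + S (b - T b)`, and `S` commutes with `σ(H)`, so the two primitives
combine to `v + S w`. -/
theorem mul {S T : E →L[ℝ] E} (hS : IsAveraging σ b H S) (hT : IsAveraging σ b H T) :
    IsAveraging σ b H (S * T) := by
  refine ⟨fun x => (hS.norm_le _).trans (hT.norm_le x), fun h hh x => ?_, ?_⟩
  · change S (T (σ h x)) = σ h (S (T x))
    rw [hT.comm h hh, hS.comm h hh]
  · obtain ⟨v, hv⟩ := hS.coboundary
    obtain ⟨w, hw⟩ := hT.coboundary
    refine ⟨v + S w, fun h hh => ?_⟩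
    change b h - S (T (b h)) = _
    have h1 : S (T (b h)) = S (b h) - S (w - σ h w) := by
      rw [← map_sub, ← hw h hh, sub_sub_cancel]
    rw [h1, map_sub, map_add, hS.comm h hh, sub_sub_eq_add_sub, add_comm (b h), add_sub_assoc,
      hv h hh]
    abel

variable [IsScalarTower ℝ 𝕜 E]

theorem map_real_smul (e : E ≃ₗᵢ[𝕜] E) (c : ℝ) (x : E) : e (c • x) = c • e x :=
  (e.toContinuousLinearEquiv : E →L[𝕜] E).map_smul_of_tower c x

theorem convex : Convex ℝ {T : E →L[ℝ] E | IsAveraging σ b H T} := by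
  intro S hS T hT s t hs ht hst
  refine ⟨fun x => ?_, fun h hh x => ?_, ?_⟩
  · change ‖s • S x + t • T x‖ ≤ ‖x‖
    calc ‖s • S x + t • T x‖ ≤ ‖s • S x‖ + ‖t • T x‖ := norm_add_le _ _
      _ = s * ‖S x‖ + t * ‖T x‖ := by
        rw [norm_smul, norm_smul, Real.norm_of_nonneg hs, Real.norm_of_nonneg ht]
      _ ≤ s * ‖x‖ + t * ‖x‖ := by
        gcongr
        · exact hS.norm_le x
        · exact hT.norm_le x
      _ = ‖x‖ := by rw [← add_mul, hst, one_mul]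
  · change s • S (σ h x) + t • T (σ h x) = σ h (s • S x + t • T x)
    rw [map_add, map_real_smul, map_real_smul, hS.comm h hh, hT.comm h hh]
  · obtain ⟨v, hv⟩ := hS.coboundary
    obtain ⟨w, hw⟩ := hT.coboundary
    refine ⟨s • v + t • w, fun h hh => ?_⟩
    change b h - (s • S (b h) + t • T (b h)) = _
    have h1 : b h = s • b h + t • b h := by rw [← add_smul, hst, one_smul]
    calc b h - (s • S (b h) + t • T (b h))
        = s • b h + t • b h - (s • S (b h) + t • T (b h)) := by rw [← h1]
      _ = s • (b h - S (b h)) + t • (b h - T (b h)) := by rw [smul_sub, smul_sub]; abel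
      _ = s • v + t • w - σ h (s • v + t • w) := by
        rw [hv h hh, hw h hh, map_add, map_real_smul, map_real_smul, smul_sub, smul_sub]; abel

/-- The operators `σ f`, for `f` commuting with `H`, are averaging. -/
theorem of_commute (hb : ∀ g f, b (g * f) = σ g (b f) + b g) {f : G} (hf : ∀ h ∈ H, Commute f h) :
    IsAveraging σ b H
      (((σ f).toContinuousLinearEquiv : E →L[𝕜] E).restrictScalars ℝ) := by
  refine ⟨fun x => ((σ f).norm_map x).le, fun h hh x => ?_, b f, fun h hh => ?_⟩
  · change σ f (σ h x) = σ h (σ f x)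
    have h1 : σ (f * h) x = σ (h * f) x := by rw [(hf h hh).eq]
    rw [map_mul, map_mul] at h1
    exact h1
  · change b h - σ f (b h) = _
    -- Expanding `b (f * h) = b (h * f)` by the cocycle rule in both orders shows that `b f` is the
    -- required primitive.
    have h1 := hb f h
    rw [(hf h hh).eq, hb h f] at h1
    rw [sub_eq_sub_iff_add_eq_add, add_comm (b h), h1, add_comm]

variable {F : Set G}

/-- Evaluation at `x` maps the convex set of averaging operators to a convex set containing the
`F`-orbit of `x`, hence its convex hull, which comes arbitrarily close to 0. -/
theorem exists_norm_apply_lt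
    (hb : ∀ g f, b (g * f) = σ g (b f) + b g)
    (hF : ∀ f ∈ F, ∀ h ∈ H, Commute f h)
    (h0 : ∀ x : E, (0 : E) ∈ closure (convexHull ℝ ((fun f => σ f x) '' F)))
    (x : E) {ε : ℝ} (hε : 0 < ε) :
    ∃ T : E →L[ℝ] E, IsAveraging σ b H T ∧ ‖T x‖ < ε := by
  obtain ⟨y, hy, hyε⟩ := Metric.mem_closure_iff.mp (h0 x) ε hε
  have hsub : convexHull ℝ ((fun f => σ f x) '' F) ⊆
      (fun T : E →L[ℝ] E => T x) '' {T | IsAveraging σ b H T} := by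
    refine convexHull_min ?_ (convex.is_linear_image ⟨fun _ _ => rfl, fun _ _ => rfl⟩)
    rintro _ ⟨f, hf, rfl⟩
    exact ⟨_, of_commute hb (hF f hf), rfl⟩
  obtain ⟨T, hT, rfl⟩ := hsub hy
  exact ⟨T, hT, by simpa using hyε⟩

/-- One vector is treated at a time: a later factor is a contraction, so it does not spoil the
bounds already obtained. -/
theorem exists_forall_finset_norm_lt
    (hb : ∀ g f, b (g * f) = σ g (b f) + b g)
    (hF : ∀ f ∈ F, ∀ h ∈ H, Commute f h)
    (h0 : ∀ x : E, (0 : E) ∈ closure (convexHull ℝ ((fun f => σ f x) '' F)))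
    (s : Finset E) {ε : ℝ} (hε : 0 < ε) :
    ∃ T : E →L[ℝ] E, IsAveraging σ b H T ∧ ∀ x ∈ s, ‖T x‖ < ε := by
  classical
  induction s using Finset.induction_on with
  | empty => exact ⟨1, one, by simp⟩
  | insert a s _ ih =>
    obtain ⟨T, hT, hTs⟩ := ih
    obtain ⟨S, hS, hSa⟩ := exists_norm_apply_lt hb hF h0 (T a) hε
    refine ⟨S * T, hS.mul hT, fun x hx => ?_⟩
    rcases Finset.mem_insert.mp hx with rfl | hx
    · exact hSa
    · exact (hS.norm_le _).trans_lt (hTs x hx)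

theorem exists_forall_isCompact_norm_lt
    (hb : ∀ g f, b (g * f) = σ g (b f) + b g)
    (hF : ∀ f ∈ F, ∀ h ∈ H, Commute f h)
    (h0 : ∀ x : E, (0 : E) ∈ closure (convexHull ℝ ((fun f => σ f x) '' F)))
    {C : Set E} (hC : IsCompact C) {ε : ℝ} (hε : 0 < ε) :
    ∃ T : E →L[ℝ] E, IsAveraging σ b H T ∧ ∀ x ∈ C, ‖T x‖ < ε := by
  obtain ⟨t, ht, hCt⟩ := Metric.totallyBounded_iff.mp hC.totallyBounded (ε / 2) (half_pos hε)
  obtain ⟨T, hT, hTt⟩ := exists_forall_finset_norm_lt hb hF h0 ht.toFinset (half_pos hε)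
  refine ⟨T, hT, fun x hx => ?_⟩
  obtain ⟨y, hy, hxy⟩ := Set.mem_iUnion₂.mp (hCt hx)
  have h1 : T x = T (x - y) + T y := by rw [map_sub, sub_add_cancel]
  rw [Metric.mem_ball, dist_eq_norm] at hxy
  rw [h1]
  calc ‖T (x - y) + T y‖ ≤ ‖x - y‖ + ‖T y‖ :=
        (norm_add_le _ _).trans (by gcongr; exact hT.norm_le _)
    _ < ε / 2 + ε / 2 := add_lt_add hxy (hTt y (by simpa using hy))
    _ = ε := by ring

end IsAveraging

/-- A cocycle on a product is approximated by coboundaries on the factor `G i` as soon as the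
closed convex hulls of the orbits of the complementary factor all contain `0`. -/
theorem restrictCocycle_mem_closureB1 {n : ℕ} {G : Fin n → Type*} [∀ i, Group (G i)]
    [∀ i, TopologicalSpace (G i)] (σ : (∀ i, G i) →* (E ≃ₗᵢ[𝕜] E)) (i : Fin n)
    (h0 : ∀ x : E, (0 : E) ∈ closure (convexHull ℝ
      ((fun f => σ f x) '' ((Pi.evalMonoidHom G i).ker : Set (∀ i, G i)))))
    (b : Z1 σ) : restrictCocycle σ i b ∈ closureB1 (restrictRep σ i) := by
  change _ ∈ closure (B1 (restrictRep σ i) : Set (Z1 (restrictRep σ i)))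
  rw [closure_subtype, mem_closure_iff_nhds_basis (nhds_basis_uniformity
    Metric.uniformity_basis_dist.compactConvergenceUniformity)]
  rintro ⟨K, ε⟩ ⟨hK, hε⟩
  set c : C(G i, E) := (restrictCocycle σ i b : C(G i, E)) with hc
  have hcb : ∀ h, c h = (b : C(∀ i, G i, E)) (Pi.mulSingle i h) := fun _ => rfl
  -- The approximant is `c - T ∘ c`, at distance `‖T (c h)‖` from `c` at `h`; hence `T` is made
  -- small on the compact set `c(K)`.
  obtain ⟨T, hT, hTK⟩ := IsAveraging.exists_forall_isCompact_norm_lt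
    (H := Set.range (Pi.mulSingle i)) b.2
    (fun f hf h hh => by
      obtain ⟨h, rfl⟩ := hh
      have hf1 : f i = 1 := hf
      refine funext fun j => ?_
      rcases eq_or_ne j i with rfl | hj
      · simp [hf1]
      · simp [Pi.mulSingle_eq_of_ne hj]) h0 (hK.image c.continuous) hε
  obtain ⟨w, hw⟩ := hT.coboundary
  have hw' : ∀ h, c h - T (c h) = w - restrictRep σ i h w := fun h => hw _ ⟨h, rfl⟩
  let d : C(G i, E) := ⟨fun h => c h - T (c h),
    c.continuous.sub (T.continuous.comp c.continuous)⟩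
  have hd : ∀ h, d h = w - restrictRep σ i h w := hw'
  have hdZ : d ∈ Z1 (restrictRep σ i) := fun g f => by
    rw [hd, hd, hd, map_mul, map_sub]
    change w - restrictRep σ i g (restrictRep σ i f w) = _
    abel
  refine ⟨d, ⟨⟨d, hdZ⟩, ⟨w, hd⟩, rfl⟩, fun h hh => ?_⟩
  change dist (d h) (c h) < ε
  rw [dist_comm, dist_eq_norm]
  change ‖c h - (c h - T (c h))‖ < ε
  rw [sub_sub_cancel]
  exact hTK _ ⟨h, hh, rfl⟩

end Cocycles

/-! ### Direct sums, and cocycles on product groups -/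

/-- A finite family of submodules onto which a family of projections with sum the identity projects,
each vanishing on the other submodules, is an internal direct sum decomposition. -/
theorem DirectSum.isInternal_of_projections {R M ι : Type*} [Ring R] [AddCommGroup M] [Module R M]
    [Fintype ι] [DecidableEq ι] (A : ι → Submodule R M) (e : ι → M →ₗ[R] M)
    (hmem : ∀ i x, e i x ∈ A i) (hid : ∀ i, ∀ x ∈ A i, e i x = x)
    (hzero : ∀ i j, i ≠ j → ∀ x ∈ A j, e i x = 0) (hsum : ∀ x, ∑ i, e i x = x) :
    DirectSum.IsInternal A := by
  rw [DirectSum.isInternal_submodule_iff_iSupIndep_and_iSup_eq_top]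
  refine ⟨iSupIndep_def.mpr fun i => Submodule.disjoint_def.mpr fun x hx hx' => ?_, ?_⟩
  · have hle : ⨆ j, ⨆ (_ : j ≠ i), A j ≤ LinearMap.ker (e i) :=
      iSup₂_le fun j hj x hx => hzero i j hj.symm x hx
    rw [← hid i x hx]
    exact hle hx'
  · refine eq_top_iff.mpr fun x _ => ?_
    rw [← hsum x]
    exact Submodule.sum_mem _ fun i _ => Submodule.mem_iSup_of_mem i (hmem i x)

/-- A cocycle on a product of groups vanishing on each factor vanishes. -/
theorem IsometricRep.restrictAll_injective {𝕜 : Type*} [RCLike 𝕜] {E : Type*}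
    [NormedAddCommGroup E] [NormedSpace 𝕜 E] {n : ℕ} {G : Fin n → Type*} [∀ i, Group (G i)]
    [∀ i, TopologicalSpace (G i)] (σ : (∀ i, G i) →* (E ≃ₗᵢ[𝕜] E)) :
    Function.Injective (restrictAll σ) := by
  rw [injective_iff_map_eq_zero]
  intro b hb
  have hcoc : ∀ g f, (b : C(∀ i, G i, E)) (g * f) =
    σ g ((b : C(∀ i, G i, E)) f) + (b : C(∀ i, G i, E)) g := b.2
  have h1 : (b : C(∀ i, G i, E)) 1 = 0 := by
    have := hcoc 1 1
    rw [mul_one, map_one σ] at this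
    simpa using this
  -- The zeros of a cocycle form a subgroup, and the finitely many factors generate the product.
  let S : Subgroup (∀ i, G i) :=
    { carrier := {g | (b : C(∀ i, G i, E)) g = 0}
      mul_mem' := fun {g f} hg hf => by
        change (b : C(∀ i, G i, E)) (g * f) = 0
        rw [hcoc, show (b : C(∀ i, G i, E)) f = 0 from hf, map_zero, zero_add]
        exact hg
      one_mem' := h1
      inv_mem' := fun {g} hg => by
        have := hcoc g⁻¹ g
        rw [inv_mul_cancel, h1, show (b : C(∀ i, G i, E)) g = 0 from hg, map_zero, zero_add] at this
        exact this.symm }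
  have hS : ∀ i (x : G i), Pi.mulSingle i x ∈ S := fun i x => by
    have h2 : restrictAll σ b i = 0 := congrFun hb i
    exact congrArg (fun c : Z1 (restrictRep σ i) => (c : C(G i, E)) x) h2
  refine Subtype.ext (ContinuousMap.ext fun g => ?_)
  exact Subgroup.pi_mem_of_mulSingle_mem g fun i => hS i (g i)

/-- If all factors but `G i` act trivially and `G i` has no nonzero invariant vector, then every
cocycle factors through `G i`. -/
theorem IsometricRep.exists_cocycle_factor {𝕜 : Type*} [RCLike 𝕜] {E : Type*}
    [NormedAddCommGroup E] [NormedSpace 𝕜 E] {n : ℕ} {G : Fin n → Type*} [∀ i, Group (G i)]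
    [∀ i, TopologicalSpace (G i)] (σ : (∀ i, G i) →* (E ≃ₗᵢ[𝕜] E)) (i : Fin n)
    (htriv : ∀ f : ∀ j, G j, f i = 1 → ∀ x, σ f x = x)
    (hinv : ∀ x, (∀ g, σ g x = x) → x = 0) :
    ∀ b ∈ Z1 σ, ∃ c ∈ Z1 (restrictRep σ i), ∀ g : ∀ j, G j, b g = c (g i) := by
  intro b hb
  have hcoc : ∀ g f, b (g * f) = σ g (b f) + b g := hb
  have hdec : ∀ g : ∀ j, G j, ∃ f : ∀ j, G j, f i = 1 ∧ g = f * Pi.mulSingle i (g i) ∧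
      g = Pi.mulSingle i (g i) * f := fun g => by
    refine ⟨Function.update g i 1, by simp, funext fun j => ?_, funext fun j => ?_⟩ <;>
    · rcases eq_or_ne j i with rfl | hj
      · simp
      · simp [hj]
  have hzero : ∀ f : ∀ j, G j, f i = 1 → b f = 0 := fun f hf => by
    refine hinv _ fun g => ?_
    obtain ⟨k, hk, hg, -⟩ := hdec g
    have hcomm : Pi.mulSingle i (g i) * f = f * Pi.mulSingle i (g i) := funext fun j => by
      rcases eq_or_ne j i with rfl | hj
      · simp [hf]
      · simp [hj]
    -- Commutation and the trivial action of `f` give `σ(g) b(f) + b(g) = b(f) + b(g)` for `g` in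
    -- the factor `G i`.
    have h1 : σ (Pi.mulSingle i (g i)) (b f) = b f := by
      have h2 := hcoc (Pi.mulSingle i (g i)) f
      rw [hcomm, hcoc, htriv f hf, add_comm] at h2
      exact (add_right_cancel h2).symm
    rw [hg, map_mul]
    change σ k (σ (Pi.mulSingle i (g i)) (b f)) = b f
    rw [h1, htriv k hk]
  refine ⟨restrictCocycle σ i ⟨b, hb⟩, (restrictCocycle σ i ⟨b, hb⟩).2, fun g => ?_⟩
  obtain ⟨f, hf, -, hg⟩ := hdec g
  change b g = b (Pi.mulSingle i (g i))
  conv_lhs => rw [hg, hcoc, hzero f hf, map_zero, zero_add]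

/-! ### The decomposition -/

theorem corollary2p4 {𝕜 : Type*} [RCLike 𝕜] {X : Type*} [NormedAddCommGroup X] [NormedSpace 𝕜 X]
    [CompleteSpace X] [TopologicalSpace.SeparableSpace X] (hX : IsReflexiveSpace 𝕜 X)
    {n : ℕ} {G : Fin n → Type*} [∀ i, Group (G i)] [∀ i, TopologicalSpace (G i)]
    [∀ i, IsTopologicalGroup (G i)]
    (π : (∀ i, G i) →* (X ≃ₗᵢ[𝕜] X)) (hπ : IsometricRep.StronglyContinuous π) :
    ∃ (V : Submodule 𝕜 X) (Y : Fin n → Submodule 𝕜 X) (W : Submodule 𝕜 X)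
      (_ : IsometricRep.IsInvariant π V) (hY : ∀ i, IsometricRep.IsInvariant π (Y i))
      (hW : IsometricRep.IsInvariant π W),
      -- the subspaces are closed, and `X = V ⊕ Y₁ ⊕ … ⊕ Yₙ ⊕ W`
      IsClosed (V : Set X) ∧ (∀ i, IsClosed (Y i : Set X)) ∧ IsClosed (W : Set X) ∧
      DirectSum.IsInternal (Sum.elim ![V, W] Y) ∧
      -- (1) `V` is the space of invariant vectors
      V = IsometricRep.invariants π ∧
      -- (2) every cocycle on `Yᵢ` factors through a cocycle on `Gᵢ`
      (∀ i, ∀ b ∈ IsometricRep.Z1 (IsometricRep.subrep π (Y i) (hY i)),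
        ∃ c ∈ IsometricRep.Z1
            (IsometricRep.restrictRep (IsometricRep.subrep π (Y i) (hY i)) i),
          ∀ g : ∀ j, G j, b g = c (g i)) ∧
      -- (3) `b ↦ (b|_{Gᵢ})ᵢ` embeds `Z¹(G, π^W)` in the direct sum of the closures of `B¹(Gᵢ, π^W)`
      Function.Injective (IsometricRep.restrictAll (IsometricRep.subrep π W hW)) ∧
      ∀ b : IsometricRep.Z1 (IsometricRep.subrep π W hW), ∀ i,
        IsometricRep.restrictAll (IsometricRep.subrep π W hW) b i ∈
          IsometricRep.closureB1
            (IsometricRep.restrictRep (IsometricRep.subrep π W hW) i) := by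
  let : NormedSpace ℝ X := NormedSpace.restrictScalars ℝ 𝕜 X
  have : IsScalarTower ℝ 𝕜 X := RestrictScalars.isScalarTower ℝ 𝕜 X
  obtain ⟨P, hPfix, hPid, hPcomm, -⟩ := exists_projection_fixedPoints hX π ⊤
  choose Q hQfix hQid hQcomm hQcl using fun i =>
    exists_projection_fixedPoints hX π (Pi.evalMonoidHom G i).ker
  simp only [Subgroup.mem_top, forall_const] at hPfix hPid
  have hQid' : ∀ i x, (∀ f : ∀ j, G j, f i = 1 → π f x = x) → Q i x = x :=
    fun i x h => hQid i x fun f hf => h f hf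
  have hQfix' : ∀ i x (f : ∀ j, G j), f i = 1 → π f (Q i x) = Q i x :=
    fun i x f hf => hQfix i x f hf
  have hPP : ∀ x, P (P x) = P x := fun x => hPid _ (hPfix x)
  have hQP : ∀ i x, Q i (P x) = P x := fun i x => hQid' i _ fun f _ => hPfix x f
  have hQQ : ∀ i x, Q i (Q i x) = Q i x := fun i x => hQid' i _ (hQfix' i x)
  have hPQ : ∀ i x, P (Q i x) = P x := fun i x => by
    have hsub : closure (convexHull ℝ
        ((fun f => π f x) '' ((Pi.evalMonoidHom G i).ker : Set (∀ j, G j)))) ⊆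
        {y | P y = P x} := by
      refine closure_minimal (convexHull_min ?_ ?_) (isClosed_eq P.continuous continuous_const)
      · rintro _ ⟨f, _, rfl⟩
        exact (hPcomm f x).trans (hPfix x f)
      · intro u hu v hv a b _ _ hab
        change P (a • u + b • v) = P x
        rw [map_add, ContinuousLinearMap.map_smul_of_tower, ContinuousLinearMap.map_smul_of_tower,
          show P u = P x from hu, show P v = P x from hv, ← add_smul, hab, one_smul]
    exact hsub (hQcl i x)
  -- `Q i (Q j x)` is `G`-fixed: the part of `g` away from `i` fixes the range of `Q i`, and the
  -- part in `G i` passes through `Q i` by equivariance and fixes `Q j x`, since its `j`-th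
  -- coordinate is 1.
  have hQQP : ∀ i j, i ≠ j → ∀ x, Q i (Q j x) = P x := fun i j hij x => by
    rw [← hPQ j, ← hPQ i]
    refine (hPid _ fun g => ?_).symm
    have hg : g = Function.update g i 1 * Pi.mulSingle i (g i) := funext fun k => by
      rcases eq_or_ne k i with rfl | hk
      · simp
      · simp [hk]
    rw [hg, map_mul]
    change π (Function.update g i 1) (π (Pi.mulSingle i (g i)) (Q i (Q j x))) = _
    rw [← hQcomm, hQfix' j x _ (by simp [hij.symm]), hQfix' i _ _ (by simp)]
  let V : Submodule 𝕜 X := invariants π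
  let Y : Fin n → Submodule 𝕜 X := fun i =>
    LinearMap.ker ((Q i : X →ₗ[𝕜] X) - LinearMap.id) ⊓ LinearMap.ker (P : X →ₗ[𝕜] X)
  let W : Submodule 𝕜 X := LinearMap.ker (P : X →ₗ[𝕜] X) ⊓ ⨅ i, LinearMap.ker (Q i : X →ₗ[𝕜] X)
  have hVmem : ∀ x, x ∈ V ↔ ∀ g, π g x = x := fun x => Iff.rfl
  have hYmem : ∀ i x, x ∈ Y i ↔ Q i x = x ∧ P x = 0 := fun i x => by
    simp [Y, sub_eq_zero]
  have hWmem : ∀ x, x ∈ W ↔ P x = 0 ∧ ∀ i, Q i x = 0 := fun x => by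
    simp [W, Submodule.mem_iInf]
  have hVP : ∀ x, x ∈ V ↔ P x = x := fun x => ⟨hPid x, fun h => h ▸ hPfix x⟩
  have hVinv : IsInvariant π V := fun g x hx => by rw [(hVmem x).mp hx g]; exact hx
  have hYinv : ∀ i, IsInvariant π (Y i) := fun i g x hx => by
    obtain ⟨h1, h2⟩ := (hYmem i x).mp hx
    rw [hYmem, hQcomm, hPcomm, h1, h2]
    exact ⟨rfl, map_zero _⟩
  have hWinv : IsInvariant π W := fun g x hx => by
    obtain ⟨h1, h2⟩ := (hWmem x).mp hx
    rw [hWmem, hPcomm, h1]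
    exact ⟨map_zero _, fun i => by rw [hQcomm, h2, map_zero]⟩
  have hVcl : IsClosed (V : Set X) := by
    have : (V : Set X) = {x | P x = x} := Set.ext hVP
    rw [this]
    exact isClosed_eq P.continuous continuous_id
  have hYcl : ∀ i, IsClosed (Y i : Set X) := fun i => by
    have : (Y i : Set X) = {x | Q i x = x} ∩ {x | P x = 0} := Set.ext (hYmem i)
    rw [this]
    exact (isClosed_eq (Q i).continuous continuous_id).inter
      (isClosed_eq P.continuous continuous_const)
  have hWcl : IsClosed (W : Set X) := by
    have : (W : Set X) = {x | P x = 0} ∩ ⋂ i, {x | Q i x = 0} := Set.ext fun x => by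
      rw [SetLike.mem_coe, hWmem]
      simp
    rw [this]
    exact (isClosed_eq P.continuous continuous_const).inter
      (isClosed_iInter fun i => isClosed_eq (Q i).continuous continuous_const)
  have hQV : ∀ i x, x ∈ V → Q i x = x := fun i x hx => hQid' i x fun f _ => (hVmem x).mp hx f
  have hQY : ∀ i j, i ≠ j → ∀ x ∈ Y j, Q i x = 0 := fun i j hij x hx => by
    obtain ⟨h1, h2⟩ := (hYmem j x).mp hx
    rw [← h1, hQQP i j hij, h2]
  refine ⟨V, Y, W, hVinv, hYinv, hWinv, hVcl, hYcl, hWcl, ?_, rfl, fun i => ?_,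
    restrictAll_injective _, fun b i => ?_⟩
  · let R : Fin n → X →ₗ[𝕜] X := fun i => (Q i - P : X →L[𝕜] X)
    have hR : ∀ i x, R i x = Q i x - P x := fun i x => rfl
    let e : Fin 2 ⊕ Fin n → X →ₗ[𝕜] X :=
      Sum.elim ![(P : X →ₗ[𝕜] X), LinearMap.id - (P : X →ₗ[𝕜] X) - ∑ i, R i] R
    have heV : ∀ x, e (Sum.inl 0) x = P x := fun x => rfl
    have heW : ∀ x, e (Sum.inl 1) x = x - P x - ∑ i, R i x := fun x => by
      simp [e]
    have heY : ∀ i x, e (Sum.inr i) x = Q i x - P x := fun i x => rfl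
    have hPR : ∀ i x, P (R i x) = 0 := fun i x => by rw [hR, map_sub, hPQ, hPP, sub_self]
    refine DirectSum.isInternal_of_projections _ e ?_ ?_ ?_ fun x => ?_
    · rintro (k | i) x
      · fin_cases k
        · exact (hVP _).mpr (hPP x)
        · refine (hWmem _).mpr ?_
          change P (e (Sum.inl 1) x) = 0 ∧ ∀ i, Q i (e (Sum.inl 1) x) = 0
          rw [heW]
          refine ⟨?_, fun i => ?_⟩
          · rw [map_sub, map_sub, hPP, sub_self, map_sum, zero_sub, neg_eq_zero]
            exact Finset.sum_eq_zero fun i _ => hPR i x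
          · rw [map_sub, map_sub, hQP, map_sum, Finset.sum_eq_single i]
            · rw [hR, map_sub, hQQ, hQP, sub_self]
            · intro j _ hj
              rw [hR, map_sub, hQQP i j hj.symm, hQP, sub_self]
            · simp
      · refine (hYmem i _).mpr ⟨?_, hPR i x⟩
        rw [heY, map_sub, hQQ, hQP]
    · rintro (k | i) x hx
      · fin_cases k
        · exact (hVP x).mp hx
        · obtain ⟨h1, h2⟩ := (hWmem x).mp hx
          change e (Sum.inl 1) x = x
          rw [heW, h1]
          simp [hR, h1, h2]
      · obtain ⟨h1, h2⟩ := (hYmem i x).mp hx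
        rw [heY, h1, h2, sub_zero]
    · have hWY : ∀ x j, x ∈ Y j → e (Sum.inl 1) x = 0 := fun x j hx => by
        obtain ⟨h1, h2⟩ := (hYmem j x).mp hx
        rw [heW, Finset.sum_eq_single j]
        · rw [hR, h1, h2, sub_zero, sub_self]
        · intro i _ hij
          rw [hR, hQY i j hij x hx, h2, sub_zero]
        · simp
      have hWV : ∀ x, x ∈ V → e (Sum.inl 1) x = 0 := fun x hx => by
        rw [heW, (hVP x).mp hx]
        simp [hR, (hVP x).mp hx, hQV _ x hx]
      rintro (k | i) (l | j) hne x hx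
      · fin_cases k <;> fin_cases l
        · exact absurd rfl hne
        · exact ((hWmem x).mp hx).1
        · exact hWV x hx
        · exact absurd rfl hne
      · fin_cases k
        · exact ((hYmem j x).mp hx).2
        · exact hWY x j hx
      · fin_cases l
        · rw [heY, hQV i x hx, (hVP x).mp hx, sub_self]
        · obtain ⟨h1, h2⟩ := (hWmem x).mp hx
          rw [heY, h1, h2, sub_self]
      · rw [heY, hQY i j (fun h => hne (h ▸ rfl)) x hx, ((hYmem j x).mp hx).2, sub_self]
    · rw [Fintype.sum_sum_type, Fin.sum_univ_two, heV, heW]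
      change P x + (x - P x - ∑ i, R i x) + ∑ i, R i x = x
      abel
  · refine exists_cocycle_factor _ i (fun f hf x => Subtype.ext ?_) fun x hx => Subtype.ext ?_
    · obtain ⟨h1, -⟩ := (hYmem i x).mp x.2
      change π f (x : X) = x
      rw [← h1, hQfix' i _ f hf]
    · have hxV : (x : X) ∈ V := fun g => congrArg Subtype.val (hx g)
      rw [← (hVP _).mp hxV, ((hYmem i x).mp x.2).2]
      rfl
  · refine restrictCocycle_mem_closureB1 _ i (fun x => ?_) b
    -- As `Q i x = 0`, this puts 0 in the closed convex hull taken in `X`; the rest transfers it to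
    -- `W`, whose inclusion is isometric and linear and so respects convex hulls.
    have hx := hQcl i (x : X)
    rw [((hWmem x).mp x.2).2 i, Metric.mem_closure_iff] at hx
    refine Metric.mem_closure_iff.mpr fun ε hε => ?_
    obtain ⟨y, hy, hyε⟩ := hx ε hε
    have himg : (fun f => π f (x : X)) '' ((Pi.evalMonoidHom G i).ker : Set (∀ j, G j)) =
        (W.subtype.restrictScalars ℝ) '' ((fun f => subrep π W hWinv f x) ''
          ((Pi.evalMonoidHom G i).ker : Set (∀ j, G j))) := by
      rw [Set.image_image]; rfl
    rw [himg, ← LinearMap.image_convexHull] at hy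
    obtain ⟨w, hw, rfl⟩ := hy
    exact ⟨w, hw, hyε⟩
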